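/- Let $0<d^-\leqslant d^+$ be real numbers. There exist positive constants $\eta=\eta(d^-,d^+)$ and $C=C(d^-,d^+)$, depending on $d^-$ and $d^+$ only, such that the following holds. Let $(d_j)_{j\geqslant 1}$ be real numbers with $d^-\leqslant d_j\leqslant d^+$ for all $j\geqslant 1$, let $(\hat f(j))_{j\geqslant 1}$ be complex numbers with $|\hat f(j)|\leqslant 1$ for all $j\geqslant 1$, and define $p_n$ and $M_n$ by $$ \sum_{n=0}^\infty p_nz^n=\exp\Bigl\{\sum_{j=1}^\infty \frac{d_j}{j}z^j\Bigr\},\qquad \sum_{n=0}^\infty M_nz^n=\exp\Bigl\{\sum_{j=1}^\infty \frac{d_j\hat f(j)}{j}z^j\Bigr\}. $$ Put, for $n\geqslant 0$ and $u>0$, $$ L_n(z)=\sum_{j=1}^n d_j\frac{\hat f(j)-1}{j}z^j,\qquad E(u)=\exp\Bigl\{2\sum_{\substack{1\leqslant k\leqslant n\\ |\hat f(k)-1|>u}}\frac{|\hat f(k)-1|}{k}\Bigr\}. $$ Then for every $n\geqslant 0$ and every $u$ with $0<u\leqslant\eta$, $$ \bigl|M_n\,p_n^{-1}\bigr|\leqslant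 C\,\bigl|\exp\{L_n(1)\}\bigr|\,\bigl(E(u)\bigr)^{d^+}. $$ -/

import Mathlib

noncomputable section

namespace VoronoiMean

/-- The formal power series `∑_{k ≥ 1} (c k / k) z ^ k`; the value `c 0` is not used. -/
def logSeries {K : Type*} [Field K] (c : ℕ → K) : PowerSeries K :=
  PowerSeries.mk fun k => if k = 0 then 0 else c k / (k : K)

/-- The formal power series `exp (∑_{k ≥ 1} (c k / k) z ^ k)`. The inner series has constant
coefficient `0`, so the substitution into the exponential series is legitimate. -/
def expSeries {K : Type*} [Field K] [Algebra ℚ K] (c : ℕ → K) : PowerSeries K :=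
  (PowerSeries.exp K).subst (logSeries c)

/-- `p_n`, the coefficient of `z ^ n` in `p(z) = exp (∑_{k ≥ 1} (d_k / k) z ^ k)`. -/
def pCoeff (d : ℕ → ℝ) (n : ℕ) : ℝ :=
  PowerSeries.coeff n (expSeries d)

/-- `M_n`, the coefficient of `z ^ n` in `M(z) = exp (∑_{k ≥ 1} (d_k f_k / k) z ^ k)`. -/
def MCoeff (d : ℕ → ℝ) (f : ℕ → ℂ) (n : ℕ) : ℂ :=
  PowerSeries.coeff n (expSeries fun k => (d k : ℂ) * f k)

/-- `L_n(z) = ∑_{j=1}^n d_j (f_j - 1) / j * z ^ j`. -/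
def L (d : ℕ → ℝ) (f : ℕ → ℂ) (n : ℕ) (z : ℂ) : ℂ :=
  ∑ j ∈ Finset.Icc 1 n, (d j : ℂ) * ((f j - 1) / (j : ℂ)) * z ^ j

/-- `E(u) = exp (2 ∑_{1 ≤ k ≤ n, |f_k - 1| > u} |f_k - 1| / k)`. -/
def E (f : ℕ → ℂ) (n : ℕ) (u : ℝ) : ℝ :=
  Real.exp (2 * ∑ k ∈ Finset.Icc 1 n with u < ‖f k - 1‖, ‖f k - 1‖ / (k : ℝ))

end VoronoiMean

end

namespace VoronoiMean

open Polynomial Finset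

section Coefficients

variable {K : Type*} [Field K]

/-- The polynomial `∑_{1 ≤ k ≤ m} (c k / k) X ^ k`. -/
noncomputable def logPoly (c : ℕ → K) (m : ℕ) : K[X] :=
  ∑ j ∈ Icc 1 m, C (c j / (j : K)) * X ^ j

/-- The polynomial `∑_{1 ≤ k ≤ m} c k X ^ k`. -/
noncomputable def truncPoly (c : ℕ → K) (m : ℕ) : K[X] :=
  ∑ j ∈ Icc 1 m, C (c j) * X ^ j

/-- The Taylor polynomial `∑_{i < N} y ^ i / i!` of the exponential at `y = logPoly c m`. -/
noncomputable def expPoly (c : ℕ → K) (m N : ℕ) : K[X] :=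
  ∑ i ∈ range N, C ((i.factorial : K)⁻¹) * logPoly c m ^ i

lemma coeff_logPoly (c : ℕ → K) (m k : ℕ) :
    (logPoly c m).coeff k = if k ∈ Icc 1 m then c k / (k : K) else 0 := by
  simp [logPoly, coeff_C_mul, coeff_X_pow]

lemma coeff_truncPoly (c : ℕ → K) (m k : ℕ) :
    (truncPoly c m).coeff k = if k ∈ Icc 1 m then c k else 0 := by
  simp [truncPoly, coeff_C_mul, coeff_X_pow]

lemma eval_expPoly (c : ℕ → K) (m N : ℕ) (z : K) :
    (expPoly c m N).eval z =
      ∑ i ∈ range N, (logPoly c m).eval z ^ i / (i.factorial : K) := by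
  simp only [expPoly, eval_finsetSum, eval_mul, eval_C, eval_pow]
  exact sum_congr rfl fun i _ => by rw [div_eq_inv_mul]

lemma coeff_logSeries_pow (c : ℕ → K) {m k : ℕ} (hk : k ≤ m) (i : ℕ) :
    PowerSeries.coeff k (logSeries c ^ i) = (logPoly c m ^ i).coeff k := by
  have h1 : (PowerSeries.X : PowerSeries K) ^ (m + 1) ∣
      logSeries c - (logPoly c m : PowerSeries K) := by
    rw [PowerSeries.X_pow_dvd_iff]
    intro j hj
    rw [map_sub, Polynomial.coeff_coe, coeff_logPoly, logSeries, PowerSeries.coeff_mk]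
    rcases Nat.eq_zero_or_pos j with rfl | h0
    · simp
    · rw [if_neg h0.ne', if_pos (by simp; omega), sub_self]
  have h2 := (h1.trans (sub_dvd_pow_sub_pow _ _ i))
  rw [PowerSeries.X_pow_dvd_iff] at h2
  have := h2 k (by omega)
  rw [map_sub, sub_eq_zero] at this
  rw [this, ← Polynomial.coe_pow, Polynomial.coeff_coe]

lemma coeff_logSeries_pow_eq_zero (c : ℕ → K) {k i : ℕ} (h : k < i) :
    PowerSeries.coeff k (logSeries c ^ i) = 0 := by
  apply PowerSeries.coeff_of_lt_order
  have h1 : (1 : ℕ∞) ≤ (logSeries c).order := by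
    refine PowerSeries.le_order _ _ fun j hj => ?_
    have : j = 0 := by simpa using hj
    simp [logSeries, this]
  have h2 : (i : ℕ∞) ≤ i • (logSeries c).order := by
    simpa using nsmul_le_nsmul_right h1 i
  exact lt_of_lt_of_le (by exact_mod_cast h) (h2.trans (PowerSeries.le_order_pow _ _))

variable [Algebra ℚ K]

lemma coeff_expSeries (c : ℕ → K) {m N k : ℕ} (hk : k ≤ m) (hN : k < N) :
    PowerSeries.coeff k (expSeries c) = (expPoly c m N).coeff k := by
  have hs : PowerSeries.HasSubst (logSeries c) :=
    PowerSeries.HasSubst.of_constantCoeff_zero' (by simp [logSeries])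
  rw [expSeries, PowerSeries.coeff_subst' hs, finsum_eq_sum_of_support_subset (s := range N)]
  · rw [expPoly, Polynomial.finsetSum_coeff]
    refine sum_congr rfl fun i _ => ?_
    rw [coeff_C_mul, coeff_logSeries_pow c hk, PowerSeries.coeff_exp, smul_eq_mul]
    simp
  · intro i hi
    by_contra h
    simp only [coe_range, Set.mem_Iio, not_lt] at h
    exact hi (by simp [coeff_logSeries_pow_eq_zero c (hN.trans_le h)])

lemma X_mul_derivative_logPoly (c : ℕ → K) (m : ℕ) :
    X * derivative (logPoly c m) = truncPoly c m := by
  have := algebraRat.charZero K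
  rw [logPoly, truncPoly, derivative_sum, mul_sum]
  refine sum_congr rfl fun j hj => ?_
  have hj : 1 ≤ j := (mem_Icc.1 hj).1
  have hj' : (j : K) ≠ 0 := by exact_mod_cast (by omega : j ≠ 0)
  obtain ⟨j, rfl⟩ := Nat.exists_eq_add_of_le' hj
  rw [derivative_C_mul_X_pow, div_mul_cancel₀ _ hj', Nat.add_sub_cancel, pow_succ]
  ring

lemma derivative_expPoly (c : ℕ → K) (m N : ℕ) :
    derivative (expPoly c m (N + 1)) = derivative (logPoly c m) * expPoly c m N := by
  have := algebraRat.charZero K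
  rw [expPoly, sum_range_succ', expPoly]
  simp only [pow_zero, Nat.factorial_zero, Nat.cast_one, inv_one, map_one, mul_one,
    derivative_add, derivative_one, add_zero, derivative_sum, mul_sum]
  refine sum_congr rfl fun i _ => ?_
  rw [derivative_C_mul, derivative_pow_succ, ← mul_assoc, ← mul_assoc, ← C_mul]
  have h : ((i + 1).factorial : K)⁻¹ * ((i : K) + 1) = (i.factorial : K)⁻¹ := by
    have : (i : K) + 1 ≠ 0 := by exact_mod_cast (Nat.succ_ne_zero i)
    have : (i.factorial : K) ≠ 0 := by exact_mod_cast i.factorial_ne_zero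
    rw [Nat.factorial_succ]; push_cast; field_simp
  rw [h]; ring

lemma X_mul_derivative_expPoly (c : ℕ → K) (m N : ℕ) :
    X * derivative (expPoly c m (N + 1)) = expPoly c m N * truncPoly c m := by
  rw [derivative_expPoly, ← X_mul_derivative_logPoly]; ring

lemma natCast_mul_coeff_expSeries_eq_coeff (c : ℕ → K) {m N k : ℕ} (hk : k ≤ m) (hN : k < N) :
    (k : K) * PowerSeries.coeff k (expSeries c) = (expPoly c m N * truncPoly c m).coeff k := by
  rw [coeff_expSeries c hk (hN.trans (Nat.lt_succ_self N)), ← X_mul_derivative_expPoly]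
  cases k with
  | zero => simp
  | succ k => rw [coeff_X_mul, coeff_derivative]; push_cast; ring

lemma natCast_mul_coeff_expSeries (c : ℕ → K) (k : ℕ) :
    (k : K) * PowerSeries.coeff k (expSeries c) =
      ∑ i ∈ range k, PowerSeries.coeff i (expSeries c) * c (k - i) := by
  rw [natCast_mul_coeff_expSeries_eq_coeff c le_rfl (Nat.lt_succ_self k), coeff_mul,
    Nat.sum_antidiagonal_eq_sum_range_succ_mk, sum_range_succ, coeff_truncPoly]
  simp only [Nat.sub_self, mem_Icc, false_and, if_false, mul_zero, add_zero,
    nonpos_iff_eq_zero, one_ne_zero]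
  refine sum_congr rfl fun i hi => ?_
  have hi := mem_range.1 hi
  rw [coeff_truncPoly, if_pos (by simp; omega), coeff_expSeries c hi.le (hi.trans k.lt_succ_self)]

lemma coeff_zero_expSeries (c : ℕ → K) : PowerSeries.coeff 0 (expSeries c) = 1 := by
  rw [coeff_expSeries c le_rfl zero_lt_one]
  simp [expPoly]

end Coefficients

/-! ### Lower bound for the partial sums of `p` -/

lemma coeff_logPoly_nonneg {d : ℕ → ℝ} (hd : ∀ j, 1 ≤ j → 0 ≤ d j) (m k : ℕ) :
    0 ≤ (logPoly d m).coeff k := by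
  rw [coeff_logPoly]
  split_ifs with h
  · have := hd k (mem_Icc.1 h).1
    positivity
  · exact le_rfl

lemma coeff_pow_nonneg_mono {F G : ℝ[X]} (hF : ∀ k, 0 ≤ F.coeff k)
    (hFG : ∀ k, F.coeff k ≤ G.coeff k) (i k : ℕ) :
    0 ≤ (F ^ i).coeff k ∧ (F ^ i).coeff k ≤ (G ^ i).coeff k := by
  induction i generalizing k with
  | zero => simp only [pow_zero, coeff_one, le_refl, and_true]; split_ifs <;> norm_num
  | succ i ih =>
    rw [pow_succ, pow_succ, coeff_mul, coeff_mul]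
    exact ⟨sum_nonneg fun x _ => mul_nonneg (ih _).1 (hF _),
      sum_le_sum fun x _ => mul_le_mul (ih _).2 (hFG _) (hF _) ((ih _).1.trans (ih _).2)⟩

lemma coeff_expPoly_nonneg_mono {d : ℕ → ℝ} (hd : ∀ j, 1 ≤ j → 0 ≤ d j) {m n : ℕ} (hmn : m ≤ n)
    (N k : ℕ) :
    0 ≤ (expPoly d m N).coeff k ∧ (expPoly d m N).coeff k ≤ (expPoly d n N).coeff k := by
  have h : ∀ k, (logPoly d m).coeff k ≤ (logPoly d n).coeff k := by
    intro k
    have := coeff_logPoly_nonneg hd n k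
    rw [coeff_logPoly, coeff_logPoly] at *
    simp only [mem_Icc] at *
    split_ifs at * <;> first | omega | linarith
  have h' := coeff_pow_nonneg_mono (coeff_logPoly_nonneg hd m) h
  simp only [expPoly, finsetSum_coeff, coeff_C_mul]
  exact ⟨sum_nonneg fun i _ => mul_nonneg (by positivity) (h' i k).1,
    sum_le_sum fun i _ => mul_le_mul_of_nonneg_left (h' i k).2 (by positivity)⟩

lemma pCoeff_nonneg {d : ℕ → ℝ} (hd : ∀ j, 1 ≤ j → 0 ≤ d j) (n : ℕ) : 0 ≤ pCoeff d n := by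
  rw [pCoeff, coeff_expSeries d le_rfl n.lt_succ_self]
  exact (coeff_expPoly_nonneg_mono hd le_rfl _ _).1

lemma tendsto_exp_taylor {𝕜 : Type*} [RCLike 𝕜] (x : 𝕜) :
    Filter.Tendsto (fun N => ∑ i ∈ range N, x ^ i / (i.factorial : 𝕜)) Filter.atTop
      (nhds (NormedSpace.exp x)) := by
  exact (NormedSpace.expSeries_div_hasSum_exp x).tendsto_sum_nat

lemma eval_one_logPoly (d : ℕ → ℝ) (m : ℕ) :
    (logPoly d m).eval 1 = ∑ j ∈ Icc 1 m, d j / (j : ℝ) := by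
  simp [logPoly, eval_finsetSum]

/-- Markov's inequality for the coefficients of `exp (∑_{j ≤ m} (d_j / j) z ^ j)`. -/
lemma half_exp_le_sum_pCoeff {D : ℝ} {d : ℕ → ℝ} (hd : ∀ j, 1 ≤ j → 0 ≤ d j ∧ d j ≤ D)
    {m n : ℕ} (hmn : 2 * D * m ≤ n) (hn : 0 < n) (hm : m ≤ n) :
    Real.exp (∑ j ∈ Icc 1 m, d j / (j : ℝ)) / 2 ≤ ∑ k ∈ range n, pCoeff d k := by
  have hd0 := fun j hj => (hd j hj).1
  have key : ∀ N, n ≤ N → (expPoly d m (N + 1)).eval 1 / 2 ≤ ∑ k ∈ range n, pCoeff d k := by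
    intro N hN
    have hnn := fun k => (coeff_expPoly_nonneg_mono hd0 hm (N + 1) k).1
    set q := expPoly d m (N + 1) with hq
    obtain ⟨B, hB⟩ : ∃ B, n ≤ B ∧ q.natDegree < B ∧ (X * derivative q).natDegree < B :=
      ⟨max n (max (q.natDegree + 1) ((X * derivative q).natDegree + 1)), by omega⟩
    have h1 : ∀ k : ℕ, (X * derivative q).coeff k = k * q.coeff k := by
      intro k
      cases k with
      | zero => simp
      | succ k => rw [coeff_X_mul, coeff_derivative]; push_cast; ring
    have h2 : (X * derivative q).eval 1 = ∑ k ∈ range B, k * q.coeff k := by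
      rw [eval_eq_sum_range' hB.2.2]; simp [h1]
    have h3 : q.eval 1 = ∑ k ∈ range B, q.coeff k := by
      rw [eval_eq_sum_range' hB.2.1]; simp
    have h4 : 0 ≤ (logPoly d m).eval 1 := by
      rw [eval_one_logPoly]
      exact sum_nonneg fun j hj => div_nonneg (hd0 j (mem_Icc.1 hj).1) (Nat.cast_nonneg _)
    have h5 : 0 ≤ (expPoly d m N).eval 1 ∧ (expPoly d m N).eval 1 ≤ q.eval 1 := by
      rw [hq, eval_expPoly, eval_expPoly, sum_range_succ]
      exact ⟨sum_nonneg fun i _ => by positivity, le_add_of_nonneg_right (by positivity)⟩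
    have h6 : (truncPoly d m).eval 1 ≤ m * D := by
      have : (truncPoly d m).eval 1 = ∑ j ∈ Icc 1 m, d j := by
        simp [truncPoly, eval_finsetSum]
      rw [this]
      simpa using sum_le_card_nsmul (Icc 1 m) d D fun j hj => (hd j (mem_Icc.1 hj).1).2
    have h7 : (X * derivative q).eval 1 ≤ n / 2 * q.eval 1 := by
      rw [hq, X_mul_derivative_expPoly, eval_mul]
      calc _ ≤ (expPoly d m N).eval 1 * (m * D) := mul_le_mul_of_nonneg_left h6 h5.1
        _ ≤ (expPoly d m N).eval 1 * (n / 2) :=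
          mul_le_mul_of_nonneg_left (by linarith) h5.1
        _ ≤ _ := by rw [mul_comm]; exact mul_le_mul_of_nonneg_left h5.2 (by positivity)
    have h8 : n * q.eval 1 ≤ n * ∑ k ∈ range n, q.coeff k + ∑ k ∈ range B, k * q.coeff k := by
      rw [h3, ← sum_range_add_sum_Ico _ hB.1, mul_add, mul_sum (Ico n B),
        ← sum_range_add_sum_Ico (fun k : ℕ => (k : ℝ) * q.coeff k) hB.1]
      have h9 : ∑ k ∈ Ico n B, n * q.coeff k ≤ ∑ k ∈ Ico n B, k * q.coeff k :=
        sum_le_sum fun k hk => mul_le_mul_of_nonneg_right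
          (by exact_mod_cast (mem_Ico.1 hk).1) (hnn k)
      have h10 : 0 ≤ ∑ k ∈ range n, k * q.coeff k :=
        sum_nonneg fun k _ => mul_nonneg (Nat.cast_nonneg _) (hnn k)
      linarith
    have h11 : ∑ k ∈ range n, q.coeff k ≤ ∑ k ∈ range n, pCoeff d k := by
      refine sum_le_sum fun k hk => ?_
      have hk := mem_range.1 hk
      rw [pCoeff, coeff_expSeries d hk.le (show k < N + 1 by omega)]
      exact (coeff_expPoly_nonneg_mono hd0 hm _ _).2
    have hn' : (0 : ℝ) < n := by exact_mod_cast hn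
    refine le_trans ?_ h11
    rw [← h2] at h8
    have : n * (q.eval 1 / 2) ≤ n * ∑ k ∈ range n, q.coeff k := by linarith
    exact le_of_mul_le_mul_left this hn'
  have ht := (tendsto_exp_taylor (𝕜 := ℝ) ((logPoly d m).eval 1)).div_const 2
  replace ht := ht.comp (Filter.tendsto_add_atTop_nat 1)
  simp only [Function.comp_def] at ht
  simp only [← eval_expPoly] at ht
  rw [eval_one_logPoly, ← Real.exp_eq_exp_ℝ] at ht
  exact le_of_tendsto ht (Filter.eventually_atTop.2 ⟨n, key⟩)

/-! ### A trigonometric sum -/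

lemma norm_one_sub_mul_sum_pow_div_le {z : ℂ} (hz : ‖z‖ = 1) {J K : ℕ} (h : J ≤ K) :
    ‖(1 - z) * ∑ j ∈ Ioc J K, z ^ j / (j : ℂ)‖ ≤ 2 / ((J : ℝ) + 1) := by
  have key : ‖(1 - z) * ∑ j ∈ Ioc J K, z ^ j / (j : ℂ) + z ^ (K + 1) / ((K : ℂ) + 1)‖ ≤
      2 / ((J : ℝ) + 1) - 1 / ((K : ℝ) + 1) := by
    induction K, h using Nat.le_induction with
    | base =>
      have : ‖(J : ℂ) + 1‖ = (J : ℝ) + 1 := by exact_mod_cast Complex.norm_natCast (J + 1)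
      simp only [Ioc_self, sum_empty, mul_zero, zero_add, norm_div, norm_pow, hz, one_pow, this]
      rw [← sub_div]; norm_num
    | succ K hK ih =>
      have h1 : ((K : ℂ) + 1) ≠ 0 := by exact_mod_cast K.succ_ne_zero
      have h2 : ((K : ℂ) + 1 + 1) ≠ 0 := by exact_mod_cast (K + 1).succ_ne_zero
      have e : (1 - z) * ∑ j ∈ Ioc J (K + 1), z ^ j / (j : ℂ) +
          z ^ (K + 1 + 1) / (((K + 1 : ℕ) : ℂ) + 1) =
          ((1 - z) * ∑ j ∈ Ioc J K, z ^ j / (j : ℂ) + z ^ (K + 1) / ((K : ℂ) + 1)) +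
          z ^ (K + 2) * (((1 / ((K : ℝ) + 1 + 1) - 1 / ((K : ℝ) + 1) : ℝ)) : ℂ) := by
        rw [sum_Ioc_succ_top (by omega)]
        push_cast
        field_simp
        ring
      rw [e]
      refine (norm_add_le _ _).trans ?_
      rw [norm_mul, norm_pow, hz, one_pow, one_mul, Complex.norm_real, Real.norm_eq_abs,
        abs_of_nonpos (sub_nonpos.2 (by gcongr; linarith))]
      push_cast
      linarith
  have h2 : ‖z ^ (K + 1) / ((K : ℂ) + 1)‖ = 1 / ((K : ℝ) + 1) := by
    have : ‖(K : ℂ) + 1‖ = (K : ℝ) + 1 := by exact_mod_cast Complex.norm_natCast (K + 1)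
    rw [norm_div, norm_pow, hz, one_pow, this]
  have h3 := norm_sub_le ((1 - z) * ∑ j ∈ Ioc J K, z ^ j / (j : ℂ) + z ^ (K + 1) / ((K : ℂ) + 1))
    (z ^ (K + 1) / ((K : ℂ) + 1))
  rw [add_sub_cancel_right] at h3
  linarith

lemma norm_pow_sub_one_le {z : ℂ} (hz : ‖z‖ = 1) (j : ℕ) : ‖z ^ j - 1‖ ≤ j * ‖1 - z‖ := by
  rw [← geom_sum_mul, norm_mul, norm_sub_rev z 1]
  refine mul_le_mul_of_nonneg_right ?_ (norm_nonneg _)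
  simpa using norm_sum_le_of_le (range j) (f := fun i => z ^ i) (n := fun _ => 1)
    fun i _ => by simp [hz]

lemma sum_norm_pow_sub_one_le {z : ℂ} (hz : ‖z‖ = 1) {a b : ℝ} (ha : 0 ≤ a) (hab : 2 * a ≤ b)
    (K : ℕ) :
    ∑ j ∈ Ioc 0 K, (a * ‖z ^ j - 1‖ - b * (1 - (z ^ j).re)) / (j : ℝ) ≤ a + 2 * b := by
  have hre : ∀ j : ℕ, (z ^ j).re ≤ 1 := fun j =>
    (Complex.re_le_norm _).trans (by simp [hz])
  have hb : 0 ≤ b := by linarith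
  by_cases h1 : z = 1
  · simp only [h1, one_pow, sub_self, norm_zero, mul_zero, Complex.one_re, zero_div, sum_const_zero]
    positivity
  have hr : 0 < ‖1 - z‖ := norm_pos_iff.2 (sub_ne_zero.2 (Ne.symm h1))
  set r := ‖1 - z‖ with hr_def
  have hJ1 : (⌊1 / r⌋₊ : ℝ) * r ≤ 1 :=
    (le_div_iff₀ hr).1 (Nat.floor_le (by positivity))
  have hJ2 : 1 ≤ ((⌊1 / r⌋₊ : ℝ) + 1) * r :=
    (div_le_iff₀ hr).1 (Nat.lt_floor_add_one _).le
  have small : ∀ J : ℕ, (J : ℝ) * r ≤ 1 →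
      ∑ j ∈ Ioc 0 J, (a * ‖z ^ j - 1‖ - b * (1 - (z ^ j).re)) / (j : ℝ) ≤ a := by
    intro J hJ
    have : ∀ j ∈ Ioc 0 J, (a * ‖z ^ j - 1‖ - b * (1 - (z ^ j).re)) / (j : ℝ) ≤ a * r := by
      intro j hj
      have hj : (0 : ℝ) < j := by exact_mod_cast (mem_Ioc.1 hj).1
      rw [div_le_iff₀ hj]
      have h2 := mul_le_mul_of_nonneg_left (norm_pow_sub_one_le hz j) ha
      have h3 := mul_nonneg hb (sub_nonneg.2 (hre j))
      linarith
    have h4 := sum_le_card_nsmul _ _ _ this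
    simp only [Nat.card_Ioc, Nat.sub_zero, nsmul_eq_mul] at h4
    nlinarith
  rcases le_total K ⌊1 / r⌋₊ with hK | hK
  · have : (K : ℝ) * r ≤ 1 :=
      (mul_le_mul_of_nonneg_right (by exact_mod_cast hK) hr.le).trans hJ1
    linarith [small K this]
  · set J := ⌊1 / r⌋₊
    rw [← sum_Ioc_consecutive _ (Nat.zero_le J) hK]
    have h5 : ∑ j ∈ Ioc J K, (a * ‖z ^ j - 1‖ - b * (1 - (z ^ j).re)) / (j : ℝ) ≤
        b * (∑ j ∈ Ioc J K, z ^ j / (j : ℂ)).re := by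
      rw [Complex.re_sum, mul_sum]
      refine sum_le_sum fun j hj => ?_
      have hj : (0 : ℝ) < j := by exact_mod_cast (Nat.zero_le J).trans_lt (mem_Ioc.1 hj).1
      rw [Complex.div_natCast_re, ← mul_div_assoc]
      gcongr
      have : ‖z ^ j - 1‖ ≤ 2 := (norm_sub_le _ _).trans (by simp [hz]; norm_num)
      nlinarith
    have h6 : (∑ j ∈ Ioc J K, z ^ j / (j : ℂ)).re ≤ 2 := by
      refine (Complex.re_le_norm _).trans ?_
      have h7 := norm_one_sub_mul_sum_pow_div_le hz hK
      rw [norm_mul, le_div_iff₀ (by positivity), ← hr_def] at h7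
      have := mul_le_mul_of_nonneg_left hJ2 (norm_nonneg (∑ j ∈ Ioc J K, z ^ j / (j : ℂ)))
      linarith
    have := mul_le_mul_of_nonneg_left h6 hb
    linarith [small J hJ1]

/-! ### The majorant -/

/-- The weight whose logarithmic sum up to `n` is the logarithm of
`exp (∑_{j ≤ n} d_j / j) * |exp (L_n 1)| * E(u) ^ D`. -/
noncomputable def weight (D : ℝ) (d : ℕ → ℝ) (f : ℕ → ℂ) (u : ℝ) (j : ℕ) : ℝ :=
  d j * (f j).re + if u < ‖f j - 1‖ then 2 * D * ‖f j - 1‖ else 0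

/-- The logarithmic sum of `weight`. -/
noncomputable def logMajorant (D : ℝ) (d : ℕ → ℝ) (f : ℕ → ℂ) (u : ℝ) (n : ℕ) : ℝ :=
  ∑ j ∈ Ioc 0 n, weight D d f u j / (j : ℝ)

section Bounds

variable {δ D u : ℝ} {d : ℕ → ℝ} {f : ℕ → ℂ}

lemma half_le_weight (hδ : 0 < δ) (hu : u ≤ δ / (2 * D)) {j : ℕ} (hd : δ ≤ d j ∧ d j ≤ D) :
    δ / 2 ≤ weight D d f u j := by
  have hD : 0 < D := by linarith
  have hre : 1 - ‖f j - 1‖ ≤ (f j).re := by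
    have := (Complex.abs_re_le_norm (f j - 1))
    rw [Complex.sub_re, Complex.one_re] at this
    linarith [neg_abs_le ((f j).re - 1)]
  have h1 : d j * (1 - ‖f j - 1‖) ≤ d j * (f j).re := mul_le_mul_of_nonneg_left hre (by linarith)
  have h0 := norm_nonneg (f j - 1)
  rw [weight]
  split_ifs with h
  · nlinarith
  · rw [le_div_iff₀ (by positivity)] at hu
    have : u ≤ 1 / 2 := by
      by_contra hh
      nlinarith
    nlinarith

lemma mul_re_mul_le_weight (hδ : 0 < δ) (hu : u ≤ δ / (2 * D)) {j : ℕ}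
    (hd : δ ≤ d j ∧ d j ≤ D) {z : ℂ} (hz : ‖z‖ = 1) :
    d j * (f j * z).re ≤
      weight D d f u j + (δ / 2 * ‖z - 1‖ - δ * (1 - z.re)) := by
  have hD : 0 < D := by linarith
  have e : (f j * z).re = (f j).re - (1 - z.re) + ((f j - 1) * (z - 1)).re := by
    simp; ring
  have h1 : ((f j - 1) * (z - 1)).re ≤ ‖f j - 1‖ * ‖z - 1‖ := by
    rw [← norm_mul]; exact Complex.re_le_norm _
  have h0 := norm_nonneg (f j - 1)
  have h00 := norm_nonneg (z - 1)
  have hzr : 0 ≤ 1 - z.re := by linarith [Complex.re_le_norm z]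
  have h2 : δ * (1 - z.re) ≤ d j * (1 - z.re) := mul_le_mul_of_nonneg_right hd.1 hzr
  have h3 : d j * ((f j - 1) * (z - 1)).re ≤ D * (‖f j - 1‖ * ‖z - 1‖) :=
    (mul_le_mul_of_nonneg_left h1 (by linarith)).trans
      (mul_le_mul_of_nonneg_right hd.2 (by positivity))
  have h4 : D * (‖f j - 1‖ * ‖z - 1‖) ≤
      (if u < ‖f j - 1‖ then 2 * D * ‖f j - 1‖ else 0) + δ / 2 * ‖z - 1‖ := by
    split_ifs with h
    · have : ‖z - 1‖ ≤ 2 := (norm_sub_le _ _).trans (by simp [hz]; norm_num)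
      have := mul_le_mul_of_nonneg_left this (mul_nonneg hD.le h0)
      have : 0 ≤ δ / 2 * ‖z - 1‖ := by positivity
      linarith
    · rw [le_div_iff₀ (by positivity)] at hu
      have : D * ‖f j - 1‖ ≤ δ / 2 := by nlinarith
      have := mul_le_mul_of_nonneg_right this h00
      linarith
  rw [weight, e]
  linarith

lemma re_eval_logPoly_le (hδ : 0 < δ) (hu : u ≤ δ / (2 * D))
    (hd : ∀ j, 1 ≤ j → δ ≤ d j ∧ d j ≤ D) {z : ℂ} (hz : ‖z‖ = 1) (n : ℕ) :
    ((logPoly (fun k => (d k : ℂ) * f k) n).eval z).re ≤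
      logMajorant D d f u n + 5 / 2 * δ := by
  have h := sum_norm_pow_sub_one_le hz (half_pos hδ).le (show 2 * (δ / 2) ≤ δ by linarith) n
  rw [logMajorant, logPoly, eval_finsetSum, Complex.re_sum]
  have h2 : ∀ j ∈ Ioc 0 n, (eval z (C ((d j : ℂ) * f j / (j : ℂ)) * X ^ j)).re ≤
      weight D d f u j / (j : ℝ) +
        (δ / 2 * ‖z ^ j - 1‖ - δ * (1 - (z ^ j).re)) / (j : ℝ) := by
    intro j hj
    have hj1 := (mem_Ioc.1 hj).1
    have e : eval z (C ((d j : ℂ) * f j / (j : ℂ)) * X ^ j) =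
        ((d j : ℂ) * (f j * z ^ j)) / (j : ℂ) := by
      simp; ring
    rw [e, Complex.div_natCast_re, Complex.re_ofReal_mul, ← add_div]
    gcongr
    exact mul_re_mul_le_weight hδ hu (hd j hj1) (by simp [hz])
  have h3 := sum_le_sum h2
  rw [sum_add_distrib] at h3
  have h4 : Icc 1 n = Ioc 0 n := rfl
  rw [h4]
  linarith

lemma logMajorant_half_le (hδ : 0 < δ) (hu : u ≤ δ / (2 * D))
    (hd : ∀ j, 1 ≤ j → δ ≤ d j ∧ d j ≤ D) {n : ℕ} (hn : 0 < n) :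
    logMajorant D d f u (n / 2) + δ / 4 ≤ logMajorant D d f u n := by
  have hn' : (0 : ℝ) < n := by exact_mod_cast hn
  rw [logMajorant, logMajorant, ← sum_Ioc_consecutive _ (Nat.zero_le (n / 2)) (Nat.div_le_self n 2)]
  have h : ∀ j ∈ Ioc (n / 2) n, δ / 2 / (n : ℝ) ≤ weight D d f u j / (j : ℝ) := by
    intro j hj
    have hj := mem_Ioc.1 hj
    have h0 : 0 < j := by omega
    have := half_le_weight (f := f) hδ hu (hd j h0)
    have hjn : (j : ℝ) ≤ n := by exact_mod_cast hj.2
    have h0' : (0 : ℝ) < j := by exact_mod_cast h0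
    have : 0 ≤ weight D d f u j := by linarith
    gcongr
  have h2 := card_nsmul_le_sum _ _ _ h
  rw [Nat.card_Ioc, nsmul_eq_mul] at h2
  have h3 : (n : ℝ) ≤ 2 * ((n - n / 2 : ℕ) : ℝ) := by
    exact_mod_cast (by omega : n ≤ 2 * (n - n / 2))
  have h4 : δ / 4 ≤ ((n - n / 2 : ℕ) : ℝ) * (δ / 2 / n) := by
    calc δ / 4 = (n : ℝ) / 2 * (δ / 2 / n) := by field_simp; norm_num
      _ ≤ _ := by gcongr; linarith
  linarith

end Bounds

/-! ### A mean square estimate -/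

lemma exp_sub_sum_mono {x y : ℝ} (hx : 0 ≤ x) (hxy : x ≤ y) (N : ℕ) :
    Real.exp x - ∑ i ∈ range N, x ^ i / (i.factorial : ℝ) ≤
      Real.exp y - ∑ i ∈ range N, y ^ i / (i.factorial : ℝ) := by
  have h : ∀ t : ℝ, Filter.Tendsto (fun n => ∑ i ∈ range n, t ^ i / (i.factorial : ℝ) -
      ∑ i ∈ range N, t ^ i / (i.factorial : ℝ)) Filter.atTop
      (nhds (Real.exp t - ∑ i ∈ range N, t ^ i / (i.factorial : ℝ))) := fun t => by
    have := (tendsto_exp_taylor (𝕜 := ℝ) t).sub_const (∑ i ∈ range N, t ^ i / (i.factorial : ℝ))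
    rwa [← Real.exp_eq_exp_ℝ] at this
  refine le_of_tendsto_of_tendsto (h x) (h y) (Filter.eventually_atTop.2 ⟨N, fun n hn => ?_⟩)
  simp only [← sum_range_add_sum_Ico _ hn, add_sub_cancel_left]
  gcongr

lemma sum_sq_norm_coeff_le_circleAverage (p : ℂ[X]) (s : Finset ℕ) :
    ∑ k ∈ s, ‖p.coeff k‖ ^ 2 ≤ Real.circleAverage (fun z => ‖p.eval z‖ ^ 2) 0 1 := by
  rw [← p.sum_sq_norm_coeff_eq_circleAverage, ← sum_filter_add_sum_filter_not s (· ∈ p.support)]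
  have : ∑ k ∈ s with k ∉ p.support, ‖p.coeff k‖ ^ 2 = 0 :=
    sum_eq_zero fun k hk => by simp [notMem_support_iff.1 (mem_filter.1 hk).2]
  rw [this, add_zero]
  exact sum_le_sum_of_subset_of_nonneg (fun k hk => (mem_filter.1 hk).2)
    fun k _ _ => by positivity

lemma circleIntegrable_sq_norm_eval (p : ℂ[X]) :
    CircleIntegrable (fun z => ‖p.eval z‖ ^ 2) 0 1 :=
  ContinuousOn.circleIntegrable zero_le_one (by fun_prop)

lemma sum_sq_norm_coeff_mul_le (p q : ℂ[X]) {B : ℝ}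
    (hB : ∀ z : ℂ, ‖z‖ = 1 → ‖p.eval z‖ ≤ B) (s : Finset ℕ) :
    ∑ k ∈ s, ‖(p * q).coeff k‖ ^ 2 ≤ B ^ 2 * ∑ k ∈ q.support, ‖q.coeff k‖ ^ 2 := by
  refine (sum_sq_norm_coeff_le_circleAverage _ s).trans ?_
  rw [q.sum_sq_norm_coeff_eq_circleAverage, ← smul_eq_mul (B ^ 2), ← Real.circleAverage_fun_smul]
  refine Real.circleAverage_mono (circleIntegrable_sq_norm_eval _)
    (ContinuousOn.circleIntegrable zero_le_one (by fun_prop)) fun z hz => ?_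
  have hz : ‖z‖ = 1 := by simpa using hz
  rw [smul_eq_mul, eval_mul, norm_mul, mul_pow]
  gcongr
  exact hB z hz

lemma norm_eval_logPoly_le {c : ℕ → ℂ} {D : ℝ} (hc : ∀ j, 1 ≤ j → ‖c j‖ ≤ D) {z : ℂ}
    (hz : ‖z‖ = 1) (n : ℕ) : ‖(logPoly c n).eval z‖ ≤ n * D := by
  rw [logPoly, eval_finsetSum]
  have := norm_sum_le_of_le (Icc 1 n) (f := fun j => eval z (C (c j / (j : ℂ)) * X ^ j))
    (n := fun _ => D) fun j hj => by
      have hj := (mem_Icc.1 hj).1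
      have hj' : (1 : ℝ) ≤ j := by exact_mod_cast hj
      have := hc j hj
      simp only [eval_mul, eval_C, eval_pow, eval_X, norm_mul, norm_div, Complex.norm_natCast,
        norm_pow, hz, one_pow, mul_one]
      exact (div_le_self (norm_nonneg _) hj').trans this
  simpa using this

lemma sum_sq_norm_coeff_expSeries_le {c : ℕ → ℂ} {D W : ℝ} (hc : ∀ j, 1 ≤ j → ‖c j‖ ≤ D) {n : ℕ}
    (hW : ∀ z : ℂ, ‖z‖ = 1 → ((logPoly c n).eval z).re ≤ W) :
    ∑ k ∈ range (n + 1), ((k : ℝ) * ‖PowerSeries.coeff k (expSeries c)‖) ^ 2 ≤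
      Real.exp W ^ 2 * (n * D ^ 2) := by
  have hT : ∑ k ∈ (truncPoly c n).support, ‖(truncPoly c n).coeff k‖ ^ 2 ≤ n * D ^ 2 := by
    have hs : (truncPoly c n).support ⊆ Icc 1 n := by
      intro k hk
      by_contra h
      exact mem_support_iff.1 hk (by rw [coeff_truncPoly, if_neg h])
    refine (sum_le_sum_of_subset_of_nonneg hs fun _ _ _ => by positivity).trans ?_
    have : ∀ k ∈ Icc 1 n, ‖(truncPoly c n).coeff k‖ ^ 2 ≤ D ^ 2 := by
      intro k hk
      rw [coeff_truncPoly, if_pos hk]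
      have := hc k (mem_Icc.1 hk).1
      gcongr
    simpa using sum_le_card_nsmul _ _ _ this
  set ε : ℕ → ℝ := fun N =>
    Real.exp (n * D) - ∑ i ∈ range N, (n * D) ^ i / (i.factorial : ℝ) with hε
  have hlim : Filter.Tendsto (fun N => (Real.exp W + ε N) ^ 2 * (n * D ^ 2)) Filter.atTop
      (nhds ((Real.exp W + 0) ^ 2 * (n * D ^ 2))) := by
    have h := (tendsto_exp_taylor (𝕜 := ℝ) (n * D)).const_sub (Real.exp (n * D))
    rw [← Real.exp_eq_exp_ℝ, sub_self] at h
    exact ((h.const_add _).pow 2).mul_const _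
  rw [add_zero] at hlim
  refine ge_of_tendsto hlim (Filter.eventually_atTop.2 ⟨n + 1, fun N hN => ?_⟩)
  have hQ : ∀ z : ℂ, ‖z‖ = 1 → ‖(expPoly c n N).eval z‖ ≤ Real.exp W + ε N := by
    intro z hz
    have h1 := Complex.norm_exp_sub_sum_le_exp_norm_sub_sum ((logPoly c n).eval z) N
    rw [← eval_expPoly] at h1
    have h2 := exp_sub_sum_mono (norm_nonneg _) (norm_eval_logPoly_le hc hz n) N
    have h3 : ‖Complex.exp ((logPoly c n).eval z)‖ ≤ Real.exp W := by
      rw [Complex.norm_exp]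
      exact Real.exp_le_exp.2 (hW z hz)
    have h4 := norm_sub_norm_le ((expPoly c n N).eval z) (Complex.exp ((logPoly c n).eval z))
    rw [norm_sub_rev] at h4
    linarith
  have h := sum_sq_norm_coeff_mul_le (expPoly c n N) (truncPoly c n) hQ (range (n + 1))
  refine le_trans (le_of_eq ?_) (h.trans (mul_le_mul_of_nonneg_left hT (by positivity)))
  refine sum_congr rfl fun k hk => ?_
  have hk := mem_range.1 hk
  rw [← natCast_mul_coeff_expSeries_eq_coeff c (by omega) (by omega : k < N), norm_mul,
    Complex.norm_natCast]

lemma sum_Ioc_half_norm_coeff_expSeries_le {c : ℕ → ℂ} {D W : ℝ} (hD : 0 ≤ D)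
    (hc : ∀ j, 1 ≤ j → ‖c j‖ ≤ D) {n : ℕ} (hn : 0 < n)
    (hW : ∀ z : ℂ, ‖z‖ = 1 → ((logPoly c n).eval z).re ≤ W) :
    ∑ k ∈ Ico (n / 2 + 1) (n + 1), ‖PowerSeries.coeff k (expSeries c)‖ ≤
      2 * D * Real.exp W := by
  have hn' : (0 : ℝ) < n := by exact_mod_cast hn
  set a : ℕ → ℝ := fun k => ‖PowerSeries.coeff k (expSeries c)‖
  have h1 := sum_sq_norm_coeff_expSeries_le hc hW
  have h2 : ∑ k ∈ Ico (n / 2 + 1) (n + 1), a k ≤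
      2 / n * ∑ k ∈ Ico (n / 2 + 1) (n + 1), (k : ℝ) * a k := by
    rw [mul_sum]
    refine sum_le_sum fun k hk => ?_
    have hk := mem_Ico.1 hk
    have : (n : ℝ) ≤ 2 * k := by exact_mod_cast (by omega : n ≤ 2 * k)
    have : 1 ≤ 2 / (n : ℝ) * k := by rw [div_mul_eq_mul_div, one_le_div hn']; exact this
    have := mul_le_mul_of_nonneg_right this (norm_nonneg (PowerSeries.coeff k (expSeries c)))
    simp only [a]
    linarith
  have h3 : (∑ k ∈ Ico (n / 2 + 1) (n + 1), (k : ℝ) * a k) ^ 2 ≤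
      n * ∑ k ∈ Ico (n / 2 + 1) (n + 1), ((k : ℝ) * a k) ^ 2 := by
    refine sq_sum_le_card_mul_sum_sq.trans (mul_le_mul_of_nonneg_right ?_ (by positivity))
    rw [Nat.card_Ico]
    exact_mod_cast (by omega : n + 1 - (n / 2 + 1) ≤ n)
  have h4 : ∑ k ∈ Ico (n / 2 + 1) (n + 1), ((k : ℝ) * a k) ^ 2 ≤
      ∑ k ∈ range (n + 1), ((k : ℝ) * a k) ^ 2 :=
    sum_le_sum_of_subset_of_nonneg (fun k hk => mem_range.2 (mem_Ico.1 hk).2)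
      fun _ _ _ => by positivity
  have h5 : ∑ k ∈ Ico (n / 2 + 1) (n + 1), (k : ℝ) * a k ≤ n * (D * Real.exp W) := by
    refine le_of_sq_le_sq ?_ (by positivity)
    calc _ ≤ n * (Real.exp W ^ 2 * (n * D ^ 2)) :=
          h3.trans (mul_le_mul_of_nonneg_left (h4.trans h1) hn'.le)
      _ = _ := by ring
  calc _ ≤ _ := h2
    _ ≤ 2 / n * (n * (D * Real.exp W)) := by gcongr
    _ = _ := by field_simp

/-! ### Comparison of partial sums -/

section Comparison

variable {δ D u : ℝ} {d : ℕ → ℝ} {f : ℕ → ℂ}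

lemma norm_ofReal_mul_le (hδ : 0 < δ) (hd : ∀ j, 1 ≤ j → δ ≤ d j ∧ d j ≤ D)
    (hf : ∀ j, 1 ≤ j → ‖f j‖ ≤ 1) (j : ℕ) (hj : 1 ≤ j) : ‖(d j : ℂ) * f j‖ ≤ D := by
  have h := hd j hj
  rw [norm_mul, Complex.norm_real, Real.norm_eq_abs, abs_of_nonneg (by linarith)]
  calc d j * ‖f j‖ ≤ D * 1 :=
        mul_le_mul h.2 (hf j hj) (norm_nonneg _) (by linarith)
    _ = D := mul_one D

lemma sum_norm_MCoeff_le (hδ : 0 < δ) (hd : ∀ j, 1 ≤ j → δ ≤ d j ∧ d j ≤ D)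
    (hf : ∀ j, 1 ≤ j → ‖f j‖ ≤ 1) (hu : u ≤ δ / (2 * D)) (n : ℕ) :
    ∑ k ∈ range (n + 1), ‖MCoeff d f k‖ ≤
      (1 + 2 * D * Real.exp (5 / 2 * δ) / (1 - Real.exp (-(δ / 4)))) *
        Real.exp (logMajorant D d f u n) := by
  have hD : 0 ≤ D := by linarith [(hd 1 le_rfl).1, (hd 1 le_rfl).2]
  have hθ : 0 < 1 - Real.exp (-(δ / 4)) := by
    rw [sub_pos, Real.exp_lt_one_iff]; linarith
  set θ := Real.exp (-(δ / 4)) with hθ_def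
  set C := 2 * D * Real.exp (5 / 2 * δ) with hC
  have hC0 : 0 ≤ C := by positivity
  set A := 1 + C / (1 - θ) with hA
  have hA1 : 1 ≤ A := le_add_of_nonneg_right (by positivity)
  have hA2 : A * θ + C ≤ A := by
    have : C / (1 - θ) * (1 - θ) = C := div_mul_cancel₀ _ hθ.ne'
    nlinarith
  induction n using Nat.strong_induction_on with
  | _ n ih =>
    rcases Nat.eq_zero_or_pos n with rfl | hn
    · simpa [MCoeff, coeff_zero_expSeries, logMajorant] using hA1
    · rw [← sum_range_add_sum_Ico _ (show n / 2 + 1 ≤ n + 1 by omega)]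
      have h1 := ih (n / 2) (by omega)
      have h2 : Real.exp (logMajorant D d f u (n / 2)) ≤
          θ * Real.exp (logMajorant D d f u n) := by
        rw [hθ_def, ← Real.exp_add, Real.exp_le_exp]
        linarith [logMajorant_half_le (f := f) hδ hu hd hn]
      have h3 := sum_Ioc_half_norm_coeff_expSeries_le hD (norm_ofReal_mul_le hδ hd hf) hn
        fun z hz => re_eval_logPoly_le (f := f) hδ hu hd hz n
      rw [Real.exp_add] at h3
      have h4 := mul_le_mul_of_nonneg_left h2 (zero_le_one.trans hA1)
      have h5 := mul_le_mul_of_nonneg_right hA2 (Real.exp_pos (logMajorant D d f u n)).le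
      calc _ ≤ A * Real.exp (logMajorant D d f u (n / 2)) +
            2 * D * (Real.exp (logMajorant D d f u n) * Real.exp (5 / 2 * δ)) := add_le_add h1 h3
        _ ≤ _ := by rw [hC] at h5; linarith

lemma exp_le_sum_pCoeff (hδ : 0 < δ) (hd : ∀ j, 1 ≤ j → δ ≤ d j ∧ d j ≤ D) {n : ℕ} (hn : 0 < n) :
    Real.exp (∑ j ∈ Icc 1 n, d j / (j : ℝ)) ≤
      2 * Real.exp (D * (⌈2 * D⌉₊ + 1)) * ∑ k ∈ range n, pCoeff d k := by
  have hD : 0 ≤ D := by linarith [(hd 1 le_rfl).1, (hd 1 le_rfl).2]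
  set A := ⌈2 * D⌉₊ + 1 with hA
  have hA1 : 0 < A := Nat.succ_pos _
  have hA2 : 2 * D ≤ A := (Nat.le_ceil _).trans (by exact_mod_cast Nat.le_succ _)
  set m := n / A
  have hm : m ≤ n := Nat.div_le_self n A
  have hmn : (A : ℝ) * m ≤ n := by exact_mod_cast Nat.mul_div_le n A
  have h1 := half_exp_le_sum_pCoeff (D := D) (m := m) (n := n)
    (fun j hj => ⟨hδ.le.trans (hd j hj).1, (hd j hj).2⟩)
    ((mul_le_mul_of_nonneg_right hA2 (Nat.cast_nonneg m)).trans hmn) hn hm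
  have h2 : ∑ j ∈ Icc 1 n, d j / (j : ℝ) ≤ D * A + ∑ j ∈ Icc 1 m, d j / (j : ℝ) := by
    have e : ∀ k, Icc 1 k = Ioc 0 k := fun _ => rfl
    rw [e, e, ← sum_Ioc_consecutive _ (Nat.zero_le m) hm, add_comm]
    gcongr
    have h3 : ∀ j ∈ Ioc m n, d j / (j : ℝ) ≤ D / ((m : ℝ) + 1) := by
      intro j hj
      have hj := (mem_Ioc.1 hj).1
      have : (m : ℝ) + 1 ≤ j := by exact_mod_cast hj
      have := (hd j ((Nat.zero_le m).trans_lt hj)).2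
      gcongr
    have h4 := sum_le_card_nsmul _ _ _ h3
    rw [Nat.card_Ioc, nsmul_eq_mul] at h4
    have h5 : ((n - m : ℕ) : ℝ) ≤ A * ((m : ℝ) + 1) := by
      have : n < A * (m + 1) := Nat.lt_mul_div_succ n hA1
      exact_mod_cast (Nat.sub_le n m).trans this.le
    calc _ ≤ _ := h4
      _ ≤ A * ((m : ℝ) + 1) * (D / ((m : ℝ) + 1)) := by gcongr
      _ = D * A := by field_simp
  have e : (A : ℝ) = (⌈2 * D⌉₊ : ℝ) + 1 := by rw [hA]; push_cast; rfl
  rw [← e]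
  calc _ ≤ Real.exp (D * A + ∑ j ∈ Icc 1 m, d j / (j : ℝ)) := Real.exp_le_exp.2 h2
    _ = 2 * Real.exp (D * A) * (Real.exp (∑ j ∈ Icc 1 m, d j / (j : ℝ)) / 2) := by
      rw [Real.exp_add]; ring
    _ ≤ _ := by gcongr

lemma natCast_mul_norm_MCoeff_le (hδ : 0 < δ) (hd : ∀ j, 1 ≤ j → δ ≤ d j ∧ d j ≤ D)
    (hf : ∀ j, 1 ≤ j → ‖f j‖ ≤ 1) (n : ℕ) :
    n * ‖MCoeff d f n‖ ≤ D * ∑ k ∈ range n, ‖MCoeff d f k‖ := by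
  rw [← Complex.norm_natCast n, ← norm_mul, MCoeff, natCast_mul_coeff_expSeries, mul_sum]
  refine norm_sum_le_of_le _ fun i hi => ?_
  rw [norm_mul, mul_comm]
  exact mul_le_mul_of_nonneg_right
    (norm_ofReal_mul_le hδ hd hf (n - i) (by have := mem_range.1 hi; omega)) (norm_nonneg _)

lemma mul_sum_pCoeff_le (hδ : 0 < δ) (hd : ∀ j, 1 ≤ j → δ ≤ d j) (n : ℕ) :
    δ * ∑ k ∈ range n, pCoeff d k ≤ n * pCoeff d n := by
  rw [pCoeff, natCast_mul_coeff_expSeries, mul_sum]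
  refine sum_le_sum fun i hi => ?_
  rw [mul_comm]
  exact mul_le_mul_of_nonneg_left (hd (n - i) (by have := mem_range.1 hi; omega))
    (pCoeff_nonneg (fun j hj => hδ.le.trans (hd j hj)) i)

lemma exp_logMajorant (D : ℝ) (d : ℕ → ℝ) (f : ℕ → ℂ) (u : ℝ) (n : ℕ) :
    Real.exp (logMajorant D d f u n) =
      Real.exp (∑ j ∈ Icc 1 n, d j / (j : ℝ)) *
        (‖Complex.exp (L d f n 1)‖ * E f n u ^ D) := by
  rw [Complex.norm_exp, E, ← Real.exp_mul, ← Real.exp_add, ← Real.exp_add]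
  congr 1
  have e : Icc 1 n = Ioc 0 n := rfl
  rw [L, Complex.re_sum, mul_sum, sum_filter, sum_mul, logMajorant, e, ← sum_add_distrib,
    ← sum_add_distrib]
  refine sum_congr rfl fun j _ => ?_
  rw [one_pow, mul_one, Complex.re_ofReal_mul, Complex.div_natCast_re, weight, Complex.sub_re,
    Complex.one_re]
  split_ifs <;> ring

end Comparison

end VoronoiMean

theorem theorem7 (dMinus dPlus : ℝ) (hdMinus : 0 < dMinus) (hle : dMinus ≤ dPlus) :
    ∃ η C : ℝ, 0 < η ∧ 0 < C ∧
      ∀ d : ℕ → ℝ, (∀ j, 1 ≤ j → dMinus ≤ d j ∧ d j ≤ dPlus) →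
      ∀ f : ℕ → ℂ, (∀ j, 1 ≤ j → ‖f j‖ ≤ 1) →
      ∀ (n : ℕ) (u : ℝ), 0 < u → u ≤ η →
        ‖VoronoiMean.MCoeff d f n * ((VoronoiMean.pCoeff d n : ℝ) : ℂ)⁻¹‖ ≤
          C * ‖Complex.exp (VoronoiMean.L d f n 1)‖ * (VoronoiMean.E f n u) ^ dPlus := by
  have hD : 0 < dPlus := hdMinus.trans_le hle
  obtain ⟨A, hA0, hA⟩ : ∃ A : ℝ, 0 < A ∧ A =
      1 + 2 * dPlus * Real.exp (5 / 2 * dMinus) / (1 - Real.exp (-(dMinus / 4))) := by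
    refine ⟨_, ?_, rfl⟩
    have : 0 < 1 - Real.exp (-(dMinus / 4)) := by
      rw [sub_pos, Real.exp_lt_one_iff]; linarith
    positivity
  obtain ⟨B, hB0, hB⟩ : ∃ B : ℝ, 0 < B ∧ B = 2 * Real.exp (dPlus * (⌈2 * dPlus⌉₊ + 1)) :=
    ⟨_, by positivity, rfl⟩
  refine ⟨dMinus / (2 * dPlus), 1 + dPlus / dMinus * A * B, by positivity, by positivity, ?_⟩
  intro d hd f hf n u _ hu
  rw [mul_assoc]
  set G := ‖Complex.exp (VoronoiMean.L d f n 1)‖ * VoronoiMean.E f n u ^ dPlus with hG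
  have hG0 : 0 ≤ G := mul_nonneg (norm_nonneg _) (Real.rpow_nonneg (Real.exp_pos _).le _)
  rw [norm_mul, norm_inv, Complex.norm_real, Real.norm_eq_abs,
    abs_of_nonneg (VoronoiMean.pCoeff_nonneg (fun j hj => hdMinus.le.trans (hd j hj).1) n)]
  rcases Nat.eq_zero_or_pos n with rfl | hn
  · have hG1 : G = 1 := by simp [hG, VoronoiMean.L, VoronoiMean.E]
    have : 0 ≤ dPlus / dMinus * A * B := by positivity
    simp only [VoronoiMean.MCoeff, VoronoiMean.pCoeff, VoronoiMean.coeff_zero_expSeries, hG1,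
      norm_one, inv_one, mul_one]
    linarith
  have hn' : (0 : ℝ) < n := by exact_mod_cast hn
  set S := ∑ k ∈ Finset.range n, VoronoiMean.pCoeff d k with hS
  have h1 := VoronoiMean.natCast_mul_norm_MCoeff_le hdMinus hd hf n
  have h2 := VoronoiMean.sum_norm_MCoeff_le hdMinus hd hf hu n
  have h3 := VoronoiMean.mul_sum_pCoeff_le hdMinus (fun j hj => (hd j hj).1) n
  have h4 := VoronoiMean.exp_le_sum_pCoeff hdMinus hd hn
  rw [VoronoiMean.exp_logMajorant, ← hA, ← hG, Finset.sum_range_succ] at h2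
  rw [← hB, ← hS] at h4
  rw [← hS] at h3
  have hS0 : 0 < S := pos_of_mul_pos_right ((Real.exp_pos _).trans_le h4) hB0.le
  have hp : 0 < VoronoiMean.pCoeff d n :=
    pos_of_mul_pos_right ((mul_pos hdMinus hS0).trans_le h3) hn'.le
  rw [← div_eq_mul_inv, div_le_iff₀ hp]
  refine le_of_mul_le_mul_left ?_ hn'
  calc (n : ℝ) * ‖VoronoiMean.MCoeff d f n‖
      ≤ dPlus * ∑ k ∈ Finset.range n, ‖VoronoiMean.MCoeff d f k‖ := h1
    _ ≤ dPlus * (A * (B * S * G)) := by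
      gcongr
      refine (le_trans (le_add_of_nonneg_right (norm_nonneg _)) h2).trans ?_
      gcongr
    _ = dPlus / dMinus * A * B * G * (dMinus * S) := by field_simp
    _ ≤ dPlus / dMinus * A * B * G * (n * VoronoiMean.pCoeff d n) := by gcongr
    _ ≤ (1 + dPlus / dMinus * A * B) * G * (n * VoronoiMean.pCoeff d n) := by
      gcongr
      linarith
    _ = _ := by ring
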